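/- Let $\mathcal X$ be a real Banach space and let $\mathcal A\subset\mathcal X\times\mathcal X$ be a (possibly multivalued) m-accretive operator with dense domain, i.e. $\|x-\hat x\|\le\|(x-\hat x)+\lambda(y-\hat y)\|$ for all $(x,y),(\hat x,\hat y)\in\mathcal A$ and $\lambda\ge 0$, $\operatorname{Rank}(I+\mathcal A)=\mathcal X$ (that is, the range of $I+\mathcal A$ is $\mathcal X$), and $\overline{D(\mathcal A)}=\mathcal X$. Let $S(t)x=\lim_{n\to\infty}\big(I+\tfrac tn\mathcal A\big)^{-n}x$ for $t>0$, $S(0)x=x$, be the contraction semigroup generated by $\mathcal A$. Let $0<T<\infty$, let $\phi:[0,T]\to[0,\infty)$ be integrable, and let $\vartheta:(0,\infty)\to(0,\infty)$ be continuous and nondecreasing with $\vartheta(0^+)=0$, extended by $\vartheta(0)=0$. Let $F:[0,T]\times\mathcal X\to\mathcal X$ satisfy $$\|F(t,v)-F(t,w)\|\le \phi(t)\,\vartheta(\|v-w\|)\qquad\text{for a.e. }t\in(0,T)\text{ and all }v,w\in\mathcal X .$$ A mild solution with initial datum $u_0\in\mathcal X$ is a function $u\in C([0,T];\mathcal X)$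 such that $F(\cdot,u(\cdot))\in L^1(0,T;\mathcal X)$ and $$u(t)=S(t)u_0+\int_0^tS(t-s)F(s,u(s))\,ds,\qquad 0\le t<T .$$ Let $u,\hat u$ be mild solutions with initial data $u_0,\hat u_0\in\mathcal X$, and write $\|u-\hat u\|_{\mathbb B_t}=\sup_{0\le s\le t}\|u(s)-\hat u(s)\|$. (i) If $\|u_0-\hat u_0\|>0$, then $$\int_{\|u_0-\hat u_0\|}^{\|u-\hat u\|_{\mathbb B_t}}\frac{ds}{\vartheta(s)}\le\int_0^t\phi(s)\,ds\qquad\text{for all }0\le t\le T .$$ (ii) If the Osgood condition $\int_{0^+}\frac{ds}{\vartheta(s)}=\infty$ holds (that is, $\int_0^\varepsilon\frac{ds}{\vartheta(s)}=\infty$ for every $\varepsilon>0$) and $u_0=\hat u_0$, then $\|u-\hat u\|_{\mathbb B_t}=0$ for all $0\le t\le T$, i.e. $u=\hat u$ on $[0,T]$. -/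

import Mathlib

open Set Filter Topology MeasureTheory

/-- A (possibly multivalued) operator on `X`, given by its graph `A ⊆ X × X`, is m-accretive:
it is accretive and the range of `I + A` is the whole space. -/
structure IsMAccretive {X : Type*} [NormedAddCommGroup X] [NormedSpace ℝ X]
    (A : Set (X × X)) : Prop where
  accretive : ∀ p ∈ A, ∀ q ∈ A, ∀ lam : ℝ, 0 ≤ lam →
    ‖p.1 - q.1‖ ≤ ‖(p.1 - q.1) + lam • (p.2 - q.2)‖
  range_id_add : ∀ x : X, ∃ p ∈ A, p.1 + p.2 = x

/-- The domain `D(A)` of a multivalued operator given by its graph. -/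
def opDomain {X : Type*} (A : Set (X × X)) : Set X := Prod.fst '' A

/-- The resolvent `J_lam = (I + lam A)⁻¹`: for `lam > 0` and `A` m-accretive, `resolventMap A lam x`
is the unique `y` with `x ∈ y + lam A y`. -/
noncomputable def resolventMap {X : Type*} [NormedAddCommGroup X] [NormedSpace ℝ X]
    (A : Set (X × X)) (lam : ℝ) (x : X) : X :=
  Classical.epsilon fun y : X => ∃ z : X, (y, z) ∈ A ∧ y + lam • z = x

open Classical in
/-- The nonlinear semigroup generated by `A`, through the exponential formula
`S(t) x = lim_{n → ∞} (I + (t / n) A)^{-n} x` for `t > 0`, and `S(0) x = x`. -/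
noncomputable def accretiveSemigroup {X : Type*} [NormedAddCommGroup X] [NormedSpace ℝ X]
    (A : Set (X × X)) (t : ℝ) (x : X) : X :=
  if t ≤ 0 then x
  else limUnder atTop fun n : ℕ => (resolventMap A (t / (n : ℝ)))^[n] x

/-- `u` is a mild solution on `[0, T]` of `u' + A u ∋ F(t, u)`, `u(0) = u₀`. -/
structure IsMildSolution {X : Type*} [NormedAddCommGroup X] [NormedSpace ℝ X]
    (A : Set (X × X)) (F : ℝ → X → X) (T : ℝ) (u₀ : X) (u : ℝ → X) : Prop where
  continuousOn : ContinuousOn u (Icc 0 T)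
  integrableOn : IntegrableOn (fun s => F s (u s)) (Ioo 0 T)
  eq_duhamel : ∀ t : ℝ, 0 ≤ t → t < T →
    u t = accretiveSemigroup A t u₀ + ∫ s in (0 : ℝ)..t, accretiveSemigroup A (t - s) (F s (u s))

/-- The norm `sup_{0 ≤ s ≤ t} ‖w(s)‖` of `C([0, t] : X)`, for `w` continuous on `[0, t]`. -/
noncomputable def supNormUpTo {X : Type*} [NormedAddCommGroup X] (t : ℝ) (w : ℝ → X) : ℝ :=
  sSup ((fun s => ‖w s‖) '' Icc 0 t)

/-- The Osgood condition `∫_{0⁺} ds / ϑ(s) = ∞`. -/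
def OsgoodCondition (ϑ : ℝ → ℝ) : Prop :=
  ∀ ε : ℝ, 0 < ε → ∫⁻ s in Ioc 0 ε, ENNReal.ofReal (1 / ϑ s) = ⊤

/-!
The resolvents of an accretive operator are nonexpansive, and Kobayashi's induction shows that
`m` resolvent steps of size `s / m` and `n` steps of size `t / n` from a point of the domain differ
by `O(√((s - t) ^ 2 + s ^ 2 / m + t ^ 2 / n))`. Hence the exponential formula converges to a jointly
continuous semigroup of nonexpansive maps, and subtracting two Duhamel formulas gives
`g t ≤ H t := ‖u₀ - û₀‖ + ∫₀ᵗ φ ϑ(g)` for `g = ‖u - û‖`. The substitution `r = H s` turns this into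
`∫ dr / ϑ(r) = ∫₀ᵗ φ ϑ(g) / ϑ(H) ≤ ∫₀ᵗ φ`, where `r` runs from `‖u₀ - û₀‖` to `H t`. This holds
with lower limit `0` as well, and there the Osgood condition forces `g = 0`.
-/

section Iterate

variable {α : Type*} [PseudoMetricSpace α]

theorem dist_iterate_self_le {f : α → α} (hf : LipschitzWith 1 f) (n : ℕ) (x : α) :
    dist (f^[n] x) x ≤ n * dist (f x) x := by
  induction n with
  | zero => simp
  | succ n ih =>
    rw [Function.iterate_succ_apply]
    push_cast
    have hn := (hf.iterate n).dist_le_mul (f x) x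
    rw [one_pow, NNReal.coe_one, one_mul] at hn
    linarith [dist_triangle (f^[n] (f x)) (f^[n] x) x]

theorem cauchySeq_of_forall_mem_dense {f : ℕ → α → α} (hf : ∀ n, LipschitzWith 1 (f n))
    {D : Set α} (hD : Dense D) (h : ∀ a ∈ D, CauchySeq fun n => f n a) (x : α) :
    CauchySeq fun n => f n x := by
  rw [Metric.cauchySeq_iff]
  intro ε hε
  obtain ⟨a, hax, ha⟩ := Metric.dense_iff.1 hD x (ε / 3) (by positivity)
  obtain ⟨N, hN⟩ := Metric.cauchySeq_iff.1 (h a ha) (ε / 3) (by positivity)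
  refine ⟨N, fun m hm n hn => ?_⟩
  have hclose : ∀ k, dist (f k x) (f k a) < ε / 3 := fun k =>
    ((hf k).dist_le_mul x a).trans_lt (by simpa [dist_comm] using hax)
  calc dist (f m x) (f n x) ≤ dist (f m x) (f m a) + dist (f m a) (f n a) + dist (f n a) (f n x) :=
        dist_triangle4 _ _ _ _
    _ < ε / 3 + ε / 3 + ε / 3 := by
        gcongr
        exacts [hclose m, hN m hm n hn, dist_comm (f n a) (f n x) ▸ hclose n]
    _ = ε := by ring

end Iterate

section Kobayashi

/-- Kobayashi's majorant: the distance between `m` resolvent steps of size `μ` and `n` steps of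
size `lam`, both started at a point `x` of the domain, is at most `√(kobayashiMajorant …) * ‖y‖` for
each `y ∈ A x`. It collects the squared difference of the elapsed times `m μ` and `n lam` and the
discretisation errors. -/
def kobayashiMajorant (lam μ : ℝ) (m n : ℕ) : ℝ :=
  (m * μ - n * lam) ^ 2 + m * μ ^ 2 + n * lam ^ 2

theorem kobayashiMajorant_nonneg (lam μ : ℝ) (m n : ℕ) : 0 ≤ kobayashiMajorant lam μ m n := by
  unfold kobayashiMajorant
  positivity

theorem kobayashiMajorant_recursion (lam μ : ℝ) (m n : ℕ) :
    lam * kobayashiMajorant lam μ m (n + 1) + μ * kobayashiMajorant lam μ (m + 1) n =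
      (lam + μ) * kobayashiMajorant lam μ (m + 1) (n + 1) := by
  unfold kobayashiMajorant
  push_cast
  ring

theorem kobayashiMajorant_swap (lam μ : ℝ) (m n : ℕ) :
    kobayashiMajorant μ lam n m = kobayashiMajorant lam μ m n := by
  unfold kobayashiMajorant
  ring

theorem mul_le_sqrt_kobayashiMajorant_zero (lam μ : ℝ) (m : ℕ) :
    m * μ ≤ √(kobayashiMajorant lam μ m 0) :=
  Real.le_sqrt_of_sq_le <| by
    have : 0 ≤ m * μ ^ 2 := by positivity
    simp only [kobayashiMajorant]
    push_cast
    linarith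

theorem mul_sqrt_kobayashiMajorant_add_le {lam μ : ℝ} (hlam : 0 < lam) (hμ : 0 < μ) (m n : ℕ) :
    lam * √(kobayashiMajorant lam μ m (n + 1)) + μ * √(kobayashiMajorant lam μ (m + 1) n) ≤
      (lam + μ) * √(kobayashiMajorant lam μ (m + 1) (n + 1)) := by
  have hconcave := Real.strictConcaveOn_sqrt.concaveOn.2
    (kobayashiMajorant_nonneg lam μ m (n + 1)) (kobayashiMajorant_nonneg lam μ (m + 1) n)
    (show 0 ≤ lam / (lam + μ) by positivity) (show 0 ≤ μ / (lam + μ) by positivity)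
    (by field_simp)
  have hrec : lam / (lam + μ) * kobayashiMajorant lam μ m (n + 1) +
      μ / (lam + μ) * kobayashiMajorant lam μ (m + 1) n =
        kobayashiMajorant lam μ (m + 1) (n + 1) := by
    field_simp
    rw [kobayashiMajorant_recursion]
  simp only [smul_eq_mul, hrec] at hconcave
  calc _ = (lam + μ) * (lam / (lam + μ) * √(kobayashiMajorant lam μ m (n + 1)) +
        μ / (lam + μ) * √(kobayashiMajorant lam μ (m + 1) n)) := by field_simp
    _ ≤ _ := by gcongr

end Kobayashi

/-- Accretivity of the operator with graph `A`: `IsMAccretive` without its range condition,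
which enters the estimates only through `resolventParameters`. -/
def IsAccretive {X : Type*} [NormedAddCommGroup X] [NormedSpace ℝ X] (A : Set (X × X)) : Prop :=
  ∀ p ∈ A, ∀ q ∈ A, ∀ lam : ℝ, 0 ≤ lam → ‖p.1 - q.1‖ ≤ ‖(p.1 - q.1) + lam • (p.2 - q.2)‖

/-- The positive `lam` for which `I + lam A` is onto, i.e. for which `resolventMap A lam` is
everywhere defined. -/
def resolventParameters {X : Type*} [NormedAddCommGroup X] [NormedSpace ℝ X]
    (A : Set (X × X)) : Set ℝ :=
  {lam | 0 < lam ∧ ∀ x : X, ∃ p ∈ A, p.1 + lam • p.2 = x}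

section Accretive

variable {X : Type*} [NormedAddCommGroup X] [NormedSpace ℝ X] {A : Set (X × X)} {lam μ : ℝ}

theorem resolventMap_mem (hlam : lam ∈ resolventParameters A) (x : X) :
    (resolventMap A lam x, lam⁻¹ • (x - resolventMap A lam x)) ∈ A := by
  obtain ⟨p, hp, hpx⟩ := hlam.2 x
  obtain ⟨z, hz, hzx⟩ : ∃ z, (resolventMap A lam x, z) ∈ A ∧ resolventMap A lam x + lam • z = x :=
    Classical.epsilon_spec (p := fun y => ∃ z, (y, z) ∈ A ∧ y + lam • z = x) ⟨p.1, p.2, hp, hpx⟩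
  rwa [← eq_sub_iff_add_eq'.2 hzx, inv_smul_smul₀ hlam.1.ne']

namespace IsAccretive

variable (hA : IsAccretive A)
include hA

theorem norm_fst_sub_le (hlam : 0 ≤ lam) {p q : X × X} (hp : p ∈ A) (hq : q ∈ A) :
    ‖p.1 - q.1‖ ≤ ‖(p.1 + lam • p.2) - (q.1 + lam • q.2)‖ := by
  rw [add_sub_add_comm, ← smul_sub]
  exact hA p hp q hq lam hlam

theorem lipschitzWith_resolventMap (hlam : lam ∈ resolventParameters A) :
    LipschitzWith 1 (resolventMap A lam) := by
  refine LipschitzWith.mk_one fun x y => ?_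
  have h := hA.norm_fst_sub_le hlam.1.le (resolventMap_mem hlam x) (resolventMap_mem hlam y)
  simpa only [smul_inv_smul₀ hlam.1.ne', add_sub_cancel, dist_eq_norm] using h

theorem dist_resolventMap_self_le (hlam : lam ∈ resolventParameters A) {x y : X}
    (hxy : (x, y) ∈ A) : dist (resolventMap A lam x) x ≤ lam * ‖y‖ := by
  have h := hA.norm_fst_sub_le hlam.1.le (resolventMap_mem hlam x) hxy
  simpa only [smul_inv_smul₀ hlam.1.ne', add_sub_cancel, sub_add_cancel_left, norm_neg, norm_smul,
    Real.norm_of_nonneg hlam.1.le, dist_eq_norm] using h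

theorem dist_iterate_resolventMap_self_le (hlam : lam ∈ resolventParameters A) {x y : X}
    (hxy : (x, y) ∈ A) (n : ℕ) : dist ((resolventMap A lam)^[n] x) x ≤ n * lam * ‖y‖ := by
  refine (dist_iterate_self_le (hA.lipschitzWith_resolventMap hlam) n x).trans ?_
  rw [mul_assoc]
  gcongr
  exact hA.dist_resolventMap_self_le hlam hxy

/-- `y` solves `y + μ A y ∋ x` iff it is a fixed point of
`y ↦ J_lam ((lam / μ) x + (1 - lam / μ) y)`, a contraction as soon as `|1 - lam / μ| < 1`. -/
theorem mem_resolventParameters_of_lt_two_mul [CompleteSpace X]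
    (hlam : lam ∈ resolventParameters A) (hμ : lam < 2 * μ) : μ ∈ resolventParameters A := by
  have hlam0 := hlam.1
  have hμ0 : 0 < μ := by linarith
  refine ⟨hμ0, fun x => ?_⟩
  have hratio : |1 - lam / μ| < 1 := by
    have h2 : lam / μ < 2 := by rwa [div_lt_iff₀ hμ0]
    have h0 : 0 < lam / μ := by positivity
    exact abs_lt.2 ⟨by linarith, by linarith⟩
  have hcontr : ContractingWith ‖1 - lam / μ‖₊
      fun y => resolventMap A lam ((lam / μ) • x + (1 - lam / μ) • y) := by
    refine ⟨hratio, ?_⟩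
    have h := (hA.lipschitzWith_resolventMap hlam).comp
      ((LipschitzWith.const ((lam / μ) • x)).add (lipschitzWith_smul (1 - lam / μ)))
    rwa [one_mul, zero_add] at h
  set y := ContractingWith.fixedPoint _ hcontr
  have hy : resolventMap A lam ((lam / μ) • x + (1 - lam / μ) • y) = y :=
    hcontr.fixedPoint_isFixedPt
  refine ⟨_, hy ▸ resolventMap_mem hlam ((lam / μ) • x + (1 - lam / μ) • y), ?_⟩
  dsimp only
  match_scalars <;> field_simp
  ring

/-- With weights `lam / (lam + μ)` and `μ / (lam + μ)`, this bounds the distance of two resolvent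
steps by a convex combination of the distances with one of the steps undone. -/
theorem mul_dist_resolventMap_resolventMap_le (hlam : lam ∈ resolventParameters A)
    (hμ : μ ∈ resolventParameters A) (p q : X) :
    (lam + μ) * dist (resolventMap A μ p) (resolventMap A lam q) ≤
      lam * dist p (resolventMap A lam q) + μ * dist (resolventMap A μ p) q := by
  have hlam0 := hlam.1
  have hμ0 := hμ.1
  have h := hA _ (resolventMap_mem hμ p) _ (resolventMap_mem hlam q)
    (lam * μ / (lam + μ)) (by positivity)
  simp only [dist_eq_norm]
  set P := resolventMap A μ p
  set Q := resolventMap A lam q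
  have hcomb : (P - Q) + (lam * μ / (lam + μ)) • (μ⁻¹ • (p - P) - lam⁻¹ • (q - Q))
      = (lam + μ)⁻¹ • (lam • (p - Q) + μ • (P - q)) := by
    match_scalars <;> field_simp <;> ring
  rw [hcomb, norm_smul, Real.norm_of_nonneg (by positivity), inv_mul_eq_div,
    le_div_iff₀ (by positivity), mul_comm] at h
  calc (lam + μ) * ‖P - Q‖ ≤ ‖lam • (p - Q) + μ • (P - q)‖ := h
    _ ≤ ‖lam • (p - Q)‖ + ‖μ • (P - q)‖ := norm_add_le _ _
    _ = lam * ‖p - Q‖ + μ * ‖P - q‖ := by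
        rw [norm_smul, norm_smul, Real.norm_of_nonneg hlam0.le, Real.norm_of_nonneg hμ0.le]

theorem dist_iterate_resolventMap_le (hlam : lam ∈ resolventParameters A)
    (hμ : μ ∈ resolventParameters A) {x y : X} (hxy : (x, y) ∈ A) (m n : ℕ) :
    dist ((resolventMap A μ)^[m] x) ((resolventMap A lam)^[n] x) ≤
      √(kobayashiMajorant lam μ m n) * ‖y‖ := by
  induction m generalizing n with
  | zero =>
    rw [dist_comm, ← kobayashiMajorant_swap]
    exact (hA.dist_iterate_resolventMap_self_le hlam hxy n).trans
      (mul_le_mul_of_nonneg_right (mul_le_sqrt_kobayashiMajorant_zero μ lam n) (norm_nonneg y))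
  | succ m ihm =>
    induction n with
    | zero =>
      exact (hA.dist_iterate_resolventMap_self_le hμ hxy (m + 1)).trans
        (mul_le_mul_of_nonneg_right (mul_le_sqrt_kobayashiMajorant_zero lam μ (m + 1))
          (norm_nonneg y))
    | succ n ihn =>
      have hstep := hA.mul_dist_resolventMap_resolventMap_le hlam hμ
        ((resolventMap A μ)^[m] x) ((resolventMap A lam)^[n] x)
      rw [← Function.iterate_succ_apply' (resolventMap A μ) m,
        ← Function.iterate_succ_apply' (resolventMap A lam) n] at hstep
      have hlam0 := hlam.1
      have hμ0 := hμ.1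
      refine le_of_mul_le_mul_left ?_ (add_pos hlam0 hμ0)
      calc _ ≤ _ := hstep
        _ ≤ lam * (√(kobayashiMajorant lam μ m (n + 1)) * ‖y‖) +
            μ * (√(kobayashiMajorant lam μ (m + 1) n) * ‖y‖) := by
          gcongr
          exact ihm (n + 1)
        _ = (lam * √(kobayashiMajorant lam μ m (n + 1)) +
            μ * √(kobayashiMajorant lam μ (m + 1) n)) * ‖y‖ := by ring
        _ ≤ (lam + μ) * √(kobayashiMajorant lam μ (m + 1) (n + 1)) * ‖y‖ := by
          gcongr
          exact mul_sqrt_kobayashiMajorant_add_le hlam0 hμ0 m n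
        _ = _ := by ring

theorem dist_iterate_resolventMap_div_le {x y : X} (hxy : (x, y) ∈ A) {s t : ℝ}
    {m n : ℕ} (hs : s / m ∈ resolventParameters A)
    (ht : t / n ∈ resolventParameters A) :
    dist ((resolventMap A (s / m))^[m] x) ((resolventMap A (t / n))^[n] x) ≤
      √((s - t) ^ 2 + s ^ 2 / m + t ^ 2 / n) * ‖y‖ := by
  have hm : (m : ℝ) ≠ 0 := fun h => by simpa [h] using hs.1
  have hn : (n : ℝ) ≠ 0 := fun h => by simpa [h] using ht.1
  refine (hA.dist_iterate_resolventMap_le ht hs hxy m n).trans_eq ?_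
  unfold kobayashiMajorant
  congr 2
  field_simp

end IsAccretive

theorem accretiveSemigroup_of_nonpos {t : ℝ} (ht : t ≤ 0) (x : X) : accretiveSemigroup A t x = x :=
  if_pos ht

namespace IsMAccretive

variable (hA : IsMAccretive A)
include hA

theorem isAccretive : IsAccretive A :=
  hA.accretive

variable [CompleteSpace X]

/-- The admissible parameters contain `1`, and with `lam` every `μ ≥ 2 lam / 3`. -/
theorem mem_resolventParameters {lam : ℝ} (hlam : 0 < lam) : lam ∈ resolventParameters A := by
  have hpow : ∀ (n : ℕ) (μ : ℝ), (2 / 3 : ℝ) ^ n ≤ μ → μ ∈ resolventParameters A := by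
    intro n
    induction n with
    | zero =>
      intro μ hμ
      have hone : (1 : ℝ) ∈ resolventParameters A :=
        ⟨one_pos, fun x => by simpa only [one_smul] using hA.range_id_add x⟩
      exact hA.isAccretive.mem_resolventParameters_of_lt_two_mul hone (by linarith)
    | succ n ih =>
      intro μ hμ
      rw [pow_succ] at hμ
      have hpos : (0 : ℝ) < (2 / 3) ^ n := by positivity
      exact hA.isAccretive.mem_resolventParameters_of_lt_two_mul (ih _ le_rfl) (by linarith)
  obtain ⟨n, hn⟩ := exists_pow_lt_of_lt_one hlam (by norm_num : (2 / 3 : ℝ) < 1)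
  exact hpow n lam hn.le

theorem div_mem_resolventParameters {t : ℝ} (ht : 0 < t) {n : ℕ} (hn : 0 < n) :
    t / n ∈ resolventParameters A :=
  hA.mem_resolventParameters (by positivity)

theorem lipschitzWith_iterate_resolventMap {t : ℝ} (ht : 0 < t) (n : ℕ) :
    LipschitzWith 1 (resolventMap A (t / n))^[n] := by
  rcases n.eq_zero_or_pos with rfl | hn
  · exact LipschitzWith.id
  · simpa only [one_pow] using
      (hA.isAccretive.lipschitzWith_resolventMap (hA.div_mem_resolventParameters ht hn)).iterate n

theorem cauchySeq_iterate_resolventMap_of_mem {t : ℝ} (ht : 0 < t) {x y : X} (hxy : (x, y) ∈ A) :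
    CauchySeq fun n : ℕ => (resolventMap A (t / n))^[n] x := by
  rw [← cauchySeq_shift 1]
  refine cauchySeq_of_le_tendsto_0 (fun N : ℕ => √(2 * t ^ 2 / (N + 1 : ℕ)) * ‖y‖)
    (fun m n N hm hn => ?_) ?_
  · refine (hA.isAccretive.dist_iterate_resolventMap_div_le hxy
      (hA.div_mem_resolventParameters ht m.succ_pos)
      (hA.div_mem_resolventParameters ht n.succ_pos)).trans ?_
    gcongr
    calc (t - t) ^ 2 + t ^ 2 / (m + 1 : ℕ) + t ^ 2 / (n + 1 : ℕ)
        ≤ (t - t) ^ 2 + t ^ 2 / (N + 1 : ℕ) + t ^ 2 / (N + 1 : ℕ) := by gcongr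
      _ = 2 * t ^ 2 / (N + 1 : ℕ) := by ring
  · have hlim := ((tendsto_const_div_atTop_nhds_zero_nat (2 * t ^ 2)).comp
      (tendsto_add_atTop_nat 1)).sqrt.mul_const ‖y‖
    simpa using hlim

variable (hdom : Dense (opDomain A))
include hdom

theorem tendsto_accretiveSemigroup {t : ℝ} (ht : 0 < t) (x : X) :
    Tendsto (fun n : ℕ => (resolventMap A (t / n))^[n] x) atTop (𝓝 (accretiveSemigroup A t x)) := by
  rw [accretiveSemigroup, if_neg ht.not_ge]
  refine (cauchySeq_of_forall_mem_dense (hA.lipschitzWith_iterate_resolventMap ht) hdom ?_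
    x).tendsto_limUnder
  rintro _ ⟨p, hp, rfl⟩
  exact hA.cauchySeq_iterate_resolventMap_of_mem ht hp

theorem lipschitzWith_accretiveSemigroup (t : ℝ) : LipschitzWith 1 (accretiveSemigroup A t) := by
  rcases le_or_gt t 0 with ht | ht
  · rw [funext (accretiveSemigroup_of_nonpos ht)]
    exact LipschitzWith.id
  · refine LipschitzWith.mk_one fun x y => ?_
    refine le_of_tendsto' ((hA.tendsto_accretiveSemigroup hdom ht x).dist
      (hA.tendsto_accretiveSemigroup hdom ht y)) fun n => ?_
    simpa using (hA.lipschitzWith_iterate_resolventMap ht n).dist_le_mul x y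

theorem norm_accretiveSemigroup_sub_le (t : ℝ) (x y : X) :
    ‖accretiveSemigroup A t x - accretiveSemigroup A t y‖ ≤ ‖x - y‖ := by
  simpa [dist_eq_norm] using (hA.lipschitzWith_accretiveSemigroup hdom t).dist_le_mul x y

theorem dist_accretiveSemigroup_self_le {x y : X} (hxy : (x, y) ∈ A) {t : ℝ} (ht : 0 < t) :
    dist (accretiveSemigroup A t x) x ≤ t * ‖y‖ := by
  refine le_of_tendsto ((hA.tendsto_accretiveSemigroup hdom ht x).dist tendsto_const_nhds) ?_
  filter_upwards [eventually_gt_atTop 0] with n hn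
  refine (hA.isAccretive.dist_iterate_resolventMap_self_le
    (hA.div_mem_resolventParameters ht hn) hxy n).trans_eq ?_
  field_simp

theorem lipschitzWith_accretiveSemigroup_apply {x y : X} (hxy : (x, y) ∈ A) :
    LipschitzWith ‖y‖₊ fun t => accretiveSemigroup A t x := by
  refine LipschitzWith.of_dist_le_mul fun s t => ?_
  rw [mul_comm, coe_nnnorm]
  wlog hst : s ≤ t generalizing s t
  · rw [dist_comm, dist_comm s]
    exact this t s (le_of_not_ge hst)
  rcases le_or_gt s 0 with hs | hs
  · rw [accretiveSemigroup_of_nonpos hs]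
    rcases le_or_gt t 0 with ht | ht
    · rw [accretiveSemigroup_of_nonpos ht, dist_self]
      positivity
    · rw [dist_comm, dist_comm s, Real.dist_eq]
      refine (hA.dist_accretiveSemigroup_self_le hdom hxy ht).trans ?_
      gcongr
      exact le_abs.2 (.inl (by linarith))
  · have ht := hs.trans_le hst
    have hlim : Tendsto (fun n : ℕ => √((s - t) ^ 2 + s ^ 2 / n + t ^ 2 / n) * ‖y‖) atTop
        (𝓝 (dist s t * ‖y‖)) := by
      have := ((tendsto_const_div_atTop_nhds_zero_nat (s ^ 2)).const_add ((s - t) ^ 2)).add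
        (tendsto_const_div_atTop_nhds_zero_nat (t ^ 2)) |>.sqrt.mul_const ‖y‖
      simpa [Real.sqrt_sq_eq_abs, Real.dist_eq] using this
    refine le_of_tendsto_of_tendsto ((hA.tendsto_accretiveSemigroup hdom hs x).dist
      (hA.tendsto_accretiveSemigroup hdom ht x)) hlim ?_
    filter_upwards [eventually_gt_atTop 0] with n hn
    exact hA.isAccretive.dist_iterate_resolventMap_div_le hxy
      (hA.div_mem_resolventParameters hs hn) (hA.div_mem_resolventParameters ht hn)

theorem continuous_accretiveSemigroup : Continuous fun p : ℝ × X => accretiveSemigroup A p.1 p.2 :=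
  continuous_prod_of_dense_continuous_lipschitzWith' _ 1 hdom
    (hA.lipschitzWith_accretiveSemigroup hdom) fun _ ⟨_, hp, hpx⟩ =>
      hpx ▸ (hA.lipschitzWith_accretiveSemigroup_apply hdom hp).continuous

theorem intervalIntegrable_accretiveSemigroup_sub {f : ℝ → X} {a b t : ℝ}
    (hf : IntervalIntegrable f volume a b) :
    IntervalIntegrable (fun s => accretiveSemigroup A (t - s) (f s)) volume a b := by
  have hS := hA.continuous_accretiveSemigroup hdom
  have hzero : IntervalIntegrable (fun s => accretiveSemigroup A (t - s) 0) volume a b :=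
    (hS.comp (by fun_prop : Continuous fun s : ℝ => (t - s, (0 : X)))).intervalIntegrable _ _
  have hmeas : AEStronglyMeasurable (fun s => accretiveSemigroup A (t - s) (f s))
      (volume.restrict (uIoc a b)) :=
    hS.comp_aestronglyMeasurable ((continuous_const.sub continuous_id).aestronglyMeasurable.prodMk
      (intervalIntegrable_iff.1 hf).aestronglyMeasurable)
  refine (hf.norm.add hzero.norm).mono_fun' hmeas (.of_forall fun s => ?_)
  calc ‖accretiveSemigroup A (t - s) (f s)‖
      ≤ ‖accretiveSemigroup A (t - s) (f s) - accretiveSemigroup A (t - s) 0‖ +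
        ‖accretiveSemigroup A (t - s) 0‖ := norm_le_norm_sub_add _ _
    _ ≤ ‖f s‖ + ‖accretiveSemigroup A (t - s) 0‖ := by
      simpa using hA.norm_accretiveSemigroup_sub_le hdom (t - s) (f s) 0

end IsMAccretive

end Accretive

/-- The hypothesis on `μ` says that it is the Lebesgue–Stieltjes measure `dH` on `(α, β]`. -/
theorem map_restrict_Ioc_eq_volume_restrict_Ioc {μ : Measure ℝ} {H : ℝ → ℝ} {α β : ℝ}
    (hαβ : α ≤ β) (hcont : ContinuousOn H (Icc α β)) (hmono : MonotoneOn H (Icc α β))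
    (hμ : ∀ x ∈ Icc α β, μ (Ioc α x) = ENNReal.ofReal (H x - H α)) :
    (μ.restrict (Ioc α β)).map H = volume.restrict (Ioc (H α) (H β)) := by
  have hα : α ∈ Icc α β := left_mem_Icc.2 hαβ
  have hβ : β ∈ Icc α β := right_mem_Icc.2 hαβ
  have hH : AEMeasurable H (μ.restrict (Ioc α β)) :=
    (hcont.mono Ioc_subset_Icc_self).aemeasurable measurableSet_Ioc
  have : IsFiniteMeasure (μ.restrict (Ioc α β)) := ⟨by simp [hμ β hβ]⟩
  refine Measure.ext_of_Iic _ _ fun c => ?_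
  rw [Measure.map_apply_of_aemeasurable hH measurableSet_Iic,
    Measure.restrict_apply' measurableSet_Ioc, Measure.restrict_apply' measurableSet_Ioc,
    inter_comm (Iic c), Ioc_inter_Iic, Real.volume_Ioc]
  rcases lt_or_ge c (H α) with hc | hc
  · have hempty : H ⁻¹' Iic c ∩ Ioc α β = ∅ := eq_empty_of_forall_notMem fun s hs =>
      (hc.trans_le (hmono hα (Ioc_subset_Icc_self hs.2) hs.2.1.le)).not_ge hs.1
    rw [hempty, measure_empty, ENNReal.ofReal_of_nonpos]
    linarith [min_le_right (H β) c]
  · obtain ⟨x, ⟨hx, hxc⟩, hmax⟩ : ∃ x, IsGreatest {s ∈ Icc α β | H s ≤ c} x :=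
      (isCompact_Icc.of_isClosed_subset (isClosed_Icc.isClosed_le hcont continuousOn_const)
        (sep_subset _ _)).exists_isGreatest ⟨α, hα, hc⟩
    have hpre : H ⁻¹' Iic c ∩ Ioc α β = Ioc α x := by
      ext s
      refine ⟨fun hs => ⟨hs.2.1, hmax ⟨Ioc_subset_Icc_self hs.2, hs.1⟩⟩, fun hs => ?_⟩
      have hsβ := hs.2.trans hx.2
      exact ⟨(hmono ⟨hs.1.le, hsβ⟩ hx hs.2).trans hxc, hs.1, hsβ⟩
    have hHx : H x = min (H β) c := by
      obtain ⟨y, hy, hHy⟩ := intermediate_value_Icc hx.2 (hcont.mono (Icc_subset_Icc_left hx.1))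
        ⟨le_min (hmono hx hβ hx.2) hxc, min_le_left (H β) c⟩
      have hyx : y ≤ x := hmax ⟨⟨hx.1.trans hy.1, hy.2⟩, hHy.trans_le (min_le_right _ _)⟩
      rw [← hHy, hyx.antisymm hy.1]
    rw [hpre, hμ x hx, hHx]

theorem continuousOn_add_integral {f : ℝ → ℝ} {α β : ℝ} (a : ℝ) (hαβ : α ≤ β)
    (hf : IntegrableOn f (Ioc α β)) :
    ContinuousOn (fun x => a + ∫ s in α..x, f s) (Icc α β) := by
  rw [← uIcc_of_le hαβ]
  exact continuousOn_const.add (intervalIntegral.continuousOn_primitive_interval'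
    ((intervalIntegrable_iff_integrableOn_Ioc_of_le hαβ).2 hf) left_mem_uIcc)

theorem map_withDensity_add_integral_eq {f : ℝ → ℝ} {α β : ℝ} (a : ℝ) (hαβ : α ≤ β)
    (hf : IntegrableOn f (Ioc α β)) (hf0 : ∀ s ∈ Ioc α β, 0 ≤ f s) :
    ((volume.restrict (Ioc α β)).withDensity fun s => ENNReal.ofReal (f s)).map
        (fun x => a + ∫ s in α..x, f s) =
      volume.restrict (Ioc a (a + ∫ s in α..β, f s)) := by
  set H : ℝ → ℝ := fun x => a + ∫ s in α..x, f s with hH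
  set μ : Measure ℝ := (volume.restrict (Ioc α β)).withDensity fun s => ENNReal.ofReal (f s)
  have hmono : MonotoneOn H (Icc α β) := fun x hx y hy hxy => by
    simp only [hH]
    gcongr
    refine intervalIntegral.integral_mono_interval le_rfl hx.1 hxy ?_ ?_
    · exact (ae_restrict_iff' measurableSet_Ioc).2
        (.of_forall fun s hs => hf0 s ⟨hs.1, hs.2.trans hy.2⟩)
    · exact (intervalIntegrable_iff_integrableOn_Ioc_of_le hy.1).2
        (hf.mono_set (Ioc_subset_Ioc_right hy.2))
  have hμ : ∀ x ∈ Icc α β, μ (Ioc α x) = ENNReal.ofReal (H x - H α) := fun x hx => by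
    have hsub : Ioc α x ⊆ Ioc α β := Ioc_subset_Ioc_right hx.2
    rw [withDensity_apply _ measurableSet_Ioc, Measure.restrict_restrict_of_subset hsub,
      ← ofReal_integral_eq_lintegral_ofReal (hf.mono_set hsub)
        ((ae_restrict_iff' measurableSet_Ioc).2 (.of_forall fun s hs => hf0 s (hsub hs))),
      ← intervalIntegral.integral_of_le hx.1]
    simp [hH]
  have hμβ : μ.restrict (Ioc α β) = μ := by
    rw [restrict_withDensity measurableSet_Ioc, Measure.restrict_restrict_of_subset subset_rfl]
  have hmap := map_restrict_Ioc_eq_volume_restrict_Ioc hαβ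
    (continuousOn_add_integral a hαβ hf) hmono hμ
  rw [hμβ] at hmap
  simpa [hH] using hmap

theorem lintegral_Ioc_add_integral_eq {f : ℝ → ℝ} {k : ℝ → ENNReal} {α β a : ℝ} (hαβ : α ≤ β)
    (hf : IntegrableOn f (Ioc α β)) (hf0 : ∀ s ∈ Ioc α β, 0 ≤ f s)
    (hk : AEMeasurable k (volume.restrict (Ioc a (a + ∫ s in α..β, f s)))) :
    ∫⁻ r in Ioc a (a + ∫ s in α..β, f s), k r =
      ∫⁻ s in Ioc α β, ENNReal.ofReal (f s) * k (a + ∫ r in α..s, f r) := by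
  have hmeas : AEMeasurable (fun x => a + ∫ s in α..x, f s)
      ((volume.restrict (Ioc α β)).withDensity fun s => ENNReal.ofReal (f s)) :=
    (((continuousOn_add_integral a hαβ hf).mono Ioc_subset_Icc_self).aemeasurable
      measurableSet_Ioc).mono_ac (withDensity_absolutelyContinuous _ _)
  rw [← map_withDensity_add_integral_eq a hαβ hf hf0] at hk ⊢
  rw [lintegral_map' hk hmeas]
  exact lintegral_withDensity_eq_lintegral_mul₀' hf.aemeasurable.ennreal_ofReal
    (hk.comp_aemeasurable hmeas)

theorem lintegral_one_div_le_of_le_add_integral {φ ϑ g : ℝ → ℝ} {a α β : ℝ} (hαβ : α ≤ β)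
    (ha : 0 ≤ a) (hφ : ∀ s ∈ Ioc α β, 0 ≤ φ s) (hϑ : MonotoneOn ϑ (Ici 0)) (hϑ0 : 0 ≤ ϑ 0)
    (hg : ∀ s ∈ Ioc α β, 0 ≤ g s) (hint : IntegrableOn (fun s => φ s * ϑ (g s)) (Ioc α β))
    (hle : ∀ s ∈ Ioc α β, g s ≤ a + ∫ r in α..s, φ r * ϑ (g r)) :
    ∫⁻ r in Ioc a (a + ∫ s in α..β, φ s * ϑ (g s)), ENNReal.ofReal (1 / ϑ r) ≤
      ∫⁻ s in Ioc α β, ENNReal.ofReal (φ s) := by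
  have hϑ_nonneg : ∀ r, 0 ≤ r → 0 ≤ ϑ r := fun r hr => hϑ0.trans (hϑ self_mem_Ici hr hr)
  have hmeas : AEMeasurable (fun r => ENNReal.ofReal (1 / ϑ r))
      (volume.restrict (Ioc a (a + ∫ s in α..β, φ s * ϑ (g s)))) :=
    ((aemeasurable_restrict_of_monotoneOn measurableSet_Ioc
      (hϑ.mono fun r hr => ha.trans hr.1.le)).const_div 1).ennreal_ofReal
  rw [lintegral_Ioc_add_integral_eq hαβ hint
    (fun s hs => mul_nonneg (hφ s hs) (hϑ_nonneg _ (hg s hs))) hmeas]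
  refine setLIntegral_mono' measurableSet_Ioc fun s hs => ?_
  set h := a + ∫ r in α..s, φ r * ϑ (g r)
  have hgh : ϑ (g s) ≤ ϑ h := hϑ (hg s hs) ((hg s hs).trans (hle s hs)) (hle s hs)
  have hh : 0 ≤ ϑ h := (hϑ_nonneg _ (hg s hs)).trans hgh
  rw [← ENNReal.ofReal_mul (mul_nonneg (hφ s hs) (hϑ_nonneg _ (hg s hs))), mul_assoc, mul_one_div]
  exact ENNReal.ofReal_le_ofReal
    (mul_le_of_le_one_right (hφ s hs) (div_le_one_of_le₀ hgh hh))

theorem integrableOn_mul_comp_of_monotoneOn {φ ϑ g : ℝ → ℝ} {K : Set ℝ} (hK : IsCompact K)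
    (hφ : IntegrableOn φ K) (hϑ : MonotoneOn ϑ (Ici 0)) (hg : ContinuousOn g K)
    (hg0 : ∀ s ∈ K, 0 ≤ g s) : IntegrableOn (fun s => φ s * ϑ (g s)) K := by
  obtain ⟨M, hM⟩ := hK.bddAbove_image hg
  have hmono : Monotone fun x => ϑ (max x 0) := fun x y hxy =>
    hϑ (mem_Ici.2 (le_max_right _ _)) (mem_Ici.2 (le_max_right _ _))
      (max_le_max_right 0 hxy)
  have hmax : ∀ s ∈ K, ϑ (max (g s) 0) = ϑ (g s) := fun s hs => by rw [max_eq_left (hg0 s hs)]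
  have hmeas : AEMeasurable (fun s => ϑ (g s)) (volume.restrict K) :=
    (hmono.measurable.comp_aemeasurable (hg.aemeasurable hK.measurableSet)).congr
      ((ae_restrict_iff' hK.measurableSet).2 (.of_forall hmax))
  refine hφ.mul_bdd (c := max |ϑ (max M 0)| |ϑ 0|) hmeas.aestronglyMeasurable
    ((ae_restrict_iff' hK.measurableSet).2 (.of_forall fun s hs => ?_))
  rw [Real.norm_eq_abs, max_comm]
  exact abs_le_max_abs_abs (hϑ self_mem_Ici (hg0 s hs) (hg0 s hs))
    (hϑ (hg0 s hs) (mem_Ici.2 (le_max_right _ _))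
      ((hM (mem_image_of_mem g hs)).trans (le_max_left _ _)))

theorem monotoneOn_Ici_of_monotoneOn_Ioi {ϑ : ℝ → ℝ} {a : ℝ} (hϑ : MonotoneOn ϑ (Ioi a))
    (ha : ∀ x, a < x → ϑ a ≤ ϑ x) : MonotoneOn ϑ (Ici a) := by
  rw [← Ioi_insert, monotoneOn_insert_iff]
  exact ⟨fun x hx hxa => absurd hxa (not_le.2 hx), fun x hx _ => ha x hx, hϑ⟩

theorem integral_le_integral_of_lintegral_ofReal_le {Ω Ω' : Type*} {_ : MeasurableSpace Ω}
    {_ : MeasurableSpace Ω'} {μ : Measure Ω} {ν : Measure Ω'} {f : Ω → ℝ} {g : Ω' → ℝ}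
    (hf : AEStronglyMeasurable f μ) (hf0 : 0 ≤ᵐ[μ] f) (hg : Integrable g ν) (hg0 : 0 ≤ᵐ[ν] g)
    (h : ∫⁻ x, ENNReal.ofReal (f x) ∂μ ≤ ∫⁻ x, ENNReal.ofReal (g x) ∂ν) :
    ∫ x, f x ∂μ ≤ ∫ x, g x ∂ν := by
  rw [integral_eq_lintegral_of_nonneg_ae hf0 hf,
    integral_eq_lintegral_of_nonneg_ae hg0 hg.aestronglyMeasurable]
  exact ENNReal.toReal_mono hg.lintegral_lt_top.ne h

section SupNorm

variable {X : Type*} [NormedAddCommGroup X] {w : ℝ → X} {t : ℝ}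

theorem supNormUpTo_le {c : ℝ} (ht : 0 ≤ t) (h : ∀ s ∈ Icc 0 t, ‖w s‖ ≤ c) :
    supNormUpTo t w ≤ c :=
  csSup_le ((nonempty_Icc.2 ht).image _) (forall_mem_image.2 h)

theorem norm_le_supNormUpTo (hw : ContinuousOn w (Icc 0 t)) {s : ℝ} (hs : s ∈ Icc 0 t) :
    ‖w s‖ ≤ supNormUpTo t w :=
  le_csSup (isCompact_Icc.bddAbove_image hw.norm) (mem_image_of_mem _ hs)

end SupNorm

namespace IsMildSolution

variable {X : Type*} [NormedAddCommGroup X] [NormedSpace ℝ X] {A : Set (X × X)} {T : ℝ}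
  {F G : ℝ → X → X} {u₀ v₀ : X} {u v : ℝ → X}

theorem apply_zero (hT : 0 < T) (hu : IsMildSolution A F T u₀ u) : u 0 = u₀ := by
  simpa [accretiveSemigroup_of_nonpos] using hu.eq_duhamel 0 le_rfl hT

theorem intervalIntegrable (hu : IsMildSolution A F T u₀ u) {t : ℝ} (ht : t ∈ Icc 0 T) :
    IntervalIntegrable (fun s => F s (u s)) volume 0 t :=
  (intervalIntegrable_iff_integrableOn_Ioo_of_le ht.1).2
    (hu.integrableOn.mono_set (Ioo_subset_Ioo_right ht.2))

theorem norm_sub_le_supNormUpTo (hu : IsMildSolution A F T u₀ u) (hv : IsMildSolution A G T v₀ v)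
    {s t : ℝ} (hs : s ∈ Icc 0 t) (ht : t ≤ T) :
    ‖u s - v s‖ ≤ supNormUpTo t fun r => u r - v r :=
  norm_le_supNormUpTo ((hu.continuousOn.sub hv.continuousOn).mono (Icc_subset_Icc_right ht)) hs

section Duhamel

variable [CompleteSpace X] (hA : IsMAccretive A) (hdom : Dense (opDomain A))
  (hu : IsMildSolution A F T u₀ u) (hv : IsMildSolution A G T v₀ v)
include hA hdom hu hv

theorem norm_sub_le_of_lt {t : ℝ} (ht0 : 0 ≤ t) (htT : t < T) :
    ‖u t - v t‖ ≤ ‖u₀ - v₀‖ + ∫ s in (0 : ℝ)..t, ‖F s (u s) - G s (v s)‖ := by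
  have hFu := hu.intervalIntegrable ⟨ht0, htT.le⟩
  have hGv := hv.intervalIntegrable ⟨ht0, htT.le⟩
  rw [hu.eq_duhamel t ht0 htT, hv.eq_duhamel t ht0 htT, add_sub_add_comm,
    ← intervalIntegral.integral_sub (hA.intervalIntegrable_accretiveSemigroup_sub hdom hFu)
      (hA.intervalIntegrable_accretiveSemigroup_sub hdom hGv)]
  refine (norm_add_le _ _).trans (add_le_add (hA.norm_accretiveSemigroup_sub_le hdom _ _ _) ?_)
  exact intervalIntegral.norm_integral_le_of_norm_le ht0
    (.of_forall fun s _ => hA.norm_accretiveSemigroup_sub_le hdom _ _ _) (hFu.sub hGv).norm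

theorem norm_sub_le (hT : 0 < T) {t : ℝ} (ht : t ∈ Icc 0 T) :
    ‖u t - v t‖ ≤ ‖u₀ - v₀‖ + ∫ s in (0 : ℝ)..t, ‖F s (u s) - G s (v s)‖ := by
  have hTmem := right_mem_Icc.2 hT.le
  have hint : IntegrableOn (fun s => ‖F s (u s) - G s (v s)‖) (Ioc 0 T) :=
    ((hu.intervalIntegrable hTmem).sub (hv.intervalIntegrable hTmem)).norm.1
  have hclosure : closure (Ico 0 T) = Icc 0 T := closure_Ico hT.ne
  have hleft : ContinuousOn (fun t => ‖u t - v t‖) (Icc 0 T) :=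
    (hu.continuousOn.sub hv.continuousOn).norm
  have hright := continuousOn_add_integral ‖u₀ - v₀‖ hT.le hint
  rw [← hclosure] at hleft hright ht
  exact le_on_closure (fun s hs => norm_sub_le_of_lt hA hdom hu hv hs.1 hs.2) hleft hright ht

end Duhamel

section Modulus

variable {φ ϑ : ℝ → ℝ} (hφ : IntegrableOn φ (Icc 0 T)) (hϑ : MonotoneOn ϑ (Ici 0))
include hφ hϑ

theorem intervalIntegrable_mul_modulus (hu : IsMildSolution A F T u₀ u)
    (hv : IsMildSolution A G T v₀ v) {t : ℝ} (ht : t ∈ Icc 0 T) :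
    IntervalIntegrable (fun s => φ s * ϑ ‖u s - v s‖) volume 0 t :=
  (intervalIntegrable_iff_integrableOn_Icc_of_le ht.1).2 <|
    (integrableOn_mul_comp_of_monotoneOn isCompact_Icc hφ hϑ
      (hu.continuousOn.sub hv.continuousOn).norm fun _ _ => norm_nonneg _).mono_set
        (Icc_subset_Icc_right ht.2)

variable [CompleteSpace X] (hA : IsMAccretive A) (hdom : Dense (opDomain A)) (hT : 0 < T)
  (hF : ∀ᵐ t ∂(volume.restrict (Ioo 0 T)), ∀ x y : X, ‖F t x - F t y‖ ≤ φ t * ϑ ‖x - y‖)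
  (hu : IsMildSolution A F T u₀ u) (hv : IsMildSolution A F T v₀ v)
include hA hdom hT hF hu hv

theorem norm_sub_le_of_modulus {t : ℝ} (ht : t ∈ Icc 0 T) :
    ‖u t - v t‖ ≤ ‖u₀ - v₀‖ + ∫ s in (0 : ℝ)..t, φ s * ϑ ‖u s - v s‖ := by
  refine (norm_sub_le hA hdom hu hv hT ht).trans (add_le_add_right ?_ _)
  refine intervalIntegral.integral_mono_ae_restrict ht.1
    ((hu.intervalIntegrable ht).sub (hv.intervalIntegrable ht)).norm
    (intervalIntegrable_mul_modulus hφ hϑ hu hv ht) ?_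
  rw [← restrict_Ioo_eq_restrict_Icc]
  filter_upwards [ae_restrict_of_ae_restrict_of_subset (Ioo_subset_Ioo_right ht.2) hF] with s hs
  exact hs _ _

variable (hφ0 : ∀ s ∈ Icc 0 T, 0 ≤ φ s) (hϑ0 : 0 ≤ ϑ 0)
include hφ0 hϑ0

theorem supNormUpTo_sub_le {t : ℝ} (ht : t ∈ Icc 0 T) :
    supNormUpTo t (fun s => u s - v s) ≤
      ‖u₀ - v₀‖ + ∫ s in (0 : ℝ)..t, φ s * ϑ ‖u s - v s‖ := by
  refine supNormUpTo_le ht.1 fun s hs => ?_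
  refine (norm_sub_le_of_modulus hφ hϑ hA hdom hT hF hu hv ⟨hs.1, hs.2.trans ht.2⟩).trans
    (add_le_add_right ?_ _)
  refine intervalIntegral.integral_mono_interval le_rfl hs.1 hs.2 ?_
    (intervalIntegrable_mul_modulus hφ hϑ hu hv ht)
  refine (ae_restrict_iff' measurableSet_Ioc).2 (.of_forall fun r hr => ?_)
  exact mul_nonneg (hφ0 r ⟨hr.1.le, hr.2.trans ht.2⟩)
    (hϑ0.trans (hϑ self_mem_Ici (norm_nonneg _) (norm_nonneg _)))

theorem lintegral_one_div_modulus_le {t : ℝ} (ht : t ∈ Icc 0 T) :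
    ∫⁻ r in Ioc ‖u₀ - v₀‖ (supNormUpTo t fun s => u s - v s), ENNReal.ofReal (1 / ϑ r) ≤
      ∫⁻ s in Ioc 0 t, ENNReal.ofReal (φ s) := by
  have hmem : ∀ s ∈ Ioc 0 t, s ∈ Icc 0 T := fun s hs => ⟨hs.1.le, hs.2.trans ht.2⟩
  exact (lintegral_mono_set (Ioc_subset_Ioc_right
    (supNormUpTo_sub_le hφ hϑ hA hdom hT hF hu hv hφ0 hϑ0 ht))).trans
    (lintegral_one_div_le_of_le_add_integral ht.1 (norm_nonneg _) (fun s hs => hφ0 s (hmem s hs))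
      hϑ hϑ0 (fun _ _ => norm_nonneg _) (intervalIntegrable_mul_modulus hφ hϑ hu hv ht).1
      fun s hs => norm_sub_le_of_modulus hφ hϑ hA hdom hT hF hu hv (hmem s hs))

/-- No junk value hides in the case `u₀ = v₀`: by `lintegral_one_div_modulus_le` the integral on the
left converges at `0`. -/
theorem integral_one_div_modulus_le {t : ℝ} (ht : t ∈ Icc 0 T) :
    ∫ r in ‖u₀ - v₀‖..supNormUpTo t (fun s => u s - v s), 1 / ϑ r ≤ ∫ s in (0 : ℝ)..t, φ s := by
  have hle : ‖u₀ - v₀‖ ≤ supNormUpTo t fun s => u s - v s := by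
    simpa only [hu.apply_zero hT, hv.apply_zero hT] using
      hu.norm_sub_le_supNormUpTo hv (left_mem_Icc.2 ht.1) ht.2
  have hIoc : ∀ r ∈ Ioc ‖u₀ - v₀‖ (supNormUpTo t fun s => u s - v s), 0 ≤ r :=
    fun r hr => (norm_nonneg _).trans hr.1.le
  have hmem : ∀ s ∈ Ioc 0 t, s ∈ Icc 0 T := fun s hs => ⟨hs.1.le, hs.2.trans ht.2⟩
  rw [intervalIntegral.integral_of_le hle, intervalIntegral.integral_of_le ht.1]
  refine integral_le_integral_of_lintegral_ofReal_le ?_ ?_ (hφ.mono_set hmem) ?_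
    (lintegral_one_div_modulus_le hφ hϑ hA hdom hT hF hu hv hφ0 hϑ0 ht)
  · exact ((aemeasurable_restrict_of_monotoneOn measurableSet_Ioc
      (hϑ.mono hIoc)).const_div 1).aestronglyMeasurable
  · exact (ae_restrict_iff' measurableSet_Ioc).2 (.of_forall fun r hr =>
      one_div_nonneg.2 (hϑ0.trans (hϑ self_mem_Ici (hIoc r hr) (hIoc r hr))))
  · exact (ae_restrict_iff' measurableSet_Ioc).2 (.of_forall fun s hs => hφ0 s (hmem s hs))

theorem supNormUpTo_sub_eq_zero_of_osgoodCondition (hO : OsgoodCondition ϑ)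
    (h0 : ‖u₀ - v₀‖ = 0) {t : ℝ} (ht : t ∈ Icc 0 T) : supNormUpTo t (fun s => u s - v s) = 0 := by
  have hbihari := lintegral_one_div_modulus_le hφ hϑ hA hdom hT hF hu hv hφ0 hϑ0 ht
  have hfinite : ∫⁻ s in Ioc 0 t, ENNReal.ofReal (φ s) < ⊤ :=
    (hφ.mono_set fun s hs => ⟨hs.1.le, hs.2.trans ht.2⟩).lintegral_lt_top
  refine le_antisymm (not_lt.1 fun hpos => ?_)
    ((norm_nonneg _).trans (hu.norm_sub_le_supNormUpTo hv (left_mem_Icc.2 ht.1) ht.2))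
  rw [h0, hO _ hpos] at hbihari
  exact hbihari.not_gt hfinite

end Modulus

end IsMildSolution

theorem corollary4p1_general {X : Type*} [NormedAddCommGroup X] [NormedSpace ℝ X] [CompleteSpace X]
    {A : Set (X × X)} (hA : IsMAccretive A) (hdom : Dense (opDomain A))
    {T : ℝ} (hT : 0 < T) {F : ℝ → X → X} {φ ϑ : ℝ → ℝ}
    (hφ_int : IntegrableOn φ (Icc 0 T)) (hφ_nonneg : ∀ t ∈ Icc 0 T, 0 ≤ φ t)
    (hϑ_pos : ∀ U : ℝ, 0 < U → 0 < ϑ U) (hϑ_mono : MonotoneOn ϑ (Ioi 0)) (hϑ_zero : ϑ 0 = 0)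
    (hF : ∀ᵐ t ∂(volume.restrict (Ioo 0 T)), ∀ v w : X, ‖F t v - F t w‖ ≤ φ t * ϑ ‖v - w‖)
    {u₀ û₀ : X} {u û : ℝ → X}
    (hu : IsMildSolution A F T u₀ u) (hû : IsMildSolution A F T û₀ û) :
    (∀ t ∈ Icc 0 T,
      ∫ s in ‖u₀ - û₀‖..supNormUpTo t (fun r => u r - û r), 1 / ϑ s ≤ ∫ s in (0 : ℝ)..t, φ s) ∧
    (OsgoodCondition ϑ → ‖u₀ - û₀‖ = 0 →
      (∀ t ∈ Icc 0 T, supNormUpTo t (fun r => u r - û r) = 0) ∧ EqOn u û (Icc 0 T)) := by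
  have hϑ : MonotoneOn ϑ (Ici 0) :=
    monotoneOn_Ici_of_monotoneOn_Ioi hϑ_mono fun x hx => hϑ_zero.trans_le (hϑ_pos x hx).le
  refine ⟨fun t ht => IsMildSolution.integral_one_div_modulus_le hφ_int hϑ hA hdom hT hF hu hû
    hφ_nonneg hϑ_zero.ge ht, fun hO h0 => ?_⟩
  have hsup : ∀ t ∈ Icc 0 T, supNormUpTo t (fun r => u r - û r) = 0 := fun t ht =>
    IsMildSolution.supNormUpTo_sub_eq_zero_of_osgoodCondition hφ_int hϑ hA hdom hT hF hu hû
      hφ_nonneg hϑ_zero.ge hO h0 ht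
  refine ⟨hsup, fun t ht => sub_eq_zero.1 (norm_le_zero_iff.1 ?_)⟩
  exact hsup t ht ▸ hu.norm_sub_le_supNormUpTo hû (right_mem_Icc.2 ht.1) ht.2

theorem corollary4p1 {X : Type*} [NormedAddCommGroup X] [NormedSpace ℝ X] [CompleteSpace X]
    (A : Set (X × X)) (hA : IsMAccretive A) (hdom : Dense (opDomain A))
    (T : ℝ) (hT : 0 < T) (F : ℝ → X → X) (φ ϑ : ℝ → ℝ)
    (hφ_int : IntegrableOn φ (Icc 0 T)) (hφ_nonneg : ∀ t ∈ Icc 0 T, 0 ≤ φ t)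
    (hϑ_pos : ∀ U : ℝ, 0 < U → 0 < ϑ U) (hϑ_cont : ContinuousOn ϑ (Ioi 0))
    (hϑ_mono : MonotoneOn ϑ (Ioi 0)) (hϑ_lim : Tendsto ϑ (𝓝[>] 0) (𝓝 0)) (hϑ_zero : ϑ 0 = 0)
    (hF : ∀ᵐ t ∂(volume.restrict (Ioo 0 T)), ∀ v w : X, ‖F t v - F t w‖ ≤ φ t * ϑ ‖v - w‖)
    (u₀ û₀ : X) (u û : ℝ → X)
    (hu : IsMildSolution A F T u₀ u) (hû : IsMildSolution A F T û₀ û) :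
    (0 < ‖u₀ - û₀‖ → ∀ t ∈ Icc 0 T,
      ∫ s in ‖u₀ - û₀‖..supNormUpTo t (fun r => u r - û r), 1 / ϑ s ≤ ∫ s in (0 : ℝ)..t, φ s) ∧
    (OsgoodCondition ϑ → ‖u₀ - û₀‖ = 0 →
      (∀ t ∈ Icc 0 T, supNormUpTo t (fun r => u r - û r) = 0) ∧ EqOn u û (Icc 0 T)) := by
  have h := corollary4p1_general hA hdom hT hφ_int hφ_nonneg hϑ_pos hϑ_mono hϑ_zero hF hu hû
  exact ⟨fun _ => h.1, h.2⟩
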